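/- Let $H\in[\tfrac12,1)$ and $z_0=x^1+ix^2\in\mathbb{C}$, and let $B_t=B^1_t+iB^2_t$, $t\ge 0$, be a planar fractional Brownian motion with Hurst parameter $H$ issued from $z_0$; that is, $B^1$ and $B^2$ are independent real Gaussian processes with almost surely continuous paths, with mean $\mathbb{E}(B^i_t)=x^i$ and covariance $$\operatorname{Cov}(B^i_s,B^i_t)=\tfrac12\left(s^{2H}+t^{2H}-|t-s|^{2H}\right),\qquad s,t\ge 0,\ i=1,2.$$ Then points are polar for $B$: for every $x\in\mathbb{C}$, $$\mathbb{P}\left(\exists\, t>0,\ B_t=x\right)=0.$$ -/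

import Mathlib

open MeasureTheory ProbabilityTheory
open scoped NNReal

/-- The covariance function `R(s, t) = (s^{2H} + t^{2H} - |t - s|^{2H}) / 2` of the fractional
Brownian motion with Hurst parameter `H`. -/
noncomputable def fbmCov (H : ℝ) (s t : ℝ≥0) : ℝ :=
  (1 / 2) * ((s : ℝ) ^ (2 * H) + (t : ℝ) ^ (2 * H) - |(t : ℝ) - (s : ℝ)| ^ (2 * H))

/-- `B` is a real fractional Brownian motion with Hurst parameter `H` issued from `x`: a Gaussian
process with constant mean `x`, covariance `fbmCov H`, and almost surely continuous paths. -/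
structure IsFractionalBrownian {Ω : Type*} {mΩ : MeasurableSpace Ω} (B : ℝ≥0 → Ω → ℝ)
    (H x : ℝ) (P : Measure Ω) : Prop where
  isGaussianProcess : IsGaussianProcess B P
  mean_eq : ∀ t : ℝ≥0, ∫ ω, B t ω ∂P = x
  covariance_eq : ∀ s t : ℝ≥0, cov[B s, B t; P] = fbmCov H s t
  continuous_paths : ∀ᵐ ω ∂P, Continuous (fun t : ℝ≥0 => B t ω)

/-- `B` is a planar (complex) fractional Brownian motion with Hurst parameter `H` issued from
`z₀`: its real and imaginary parts are independent real fractional Brownian motions with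
parameter `H` issued from the real and the imaginary part of `z₀`. -/
structure IsPlanarFractionalBrownian {Ω : Type*} {mΩ : MeasurableSpace Ω} (B : ℝ≥0 → Ω → ℂ)
    (H : ℝ) (z₀ : ℂ) (P : Measure Ω) : Prop where
  re : IsFractionalBrownian (fun t ω => (B t ω).re) H z₀.re P
  im : IsFractionalBrownian (fun t ω => (B t ω).im) H z₀.im P
  indep : IndepFun (fun ω (t : ℝ≥0) => (B t ω).re) (fun ω (t : ℝ≥0) => (B t ω).im) P

/-! The plane is the critical dimension for `H = 1/2`, so the two regimes need different arguments.

For `H > 1/2` a first moment bound suffices. Pick `1/2 < θ < H` and `r = 2^(-θ)`. Almost surely,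
from some level on, the path stays within a constant times `r^m` of its value at the preceding
dyadic point of level `m` (`ae_eventually_dyadic_le`, `abs_sub_floor_le_of_dyadic`). A hit of `x`
thus forces one of `T * 2^m` dyadic samples into a square of side of order `r^m`. Away from time
zero each does so with probability `O(r^(2m))` (`measureReal_square_le`), and the total `O((2r²)^m)`
tends to zero.

For `H = 1/2` this sum no longer vanishes, but the Markov property gains a logarithm. After first
entering a square of half-side `r`, a sampled path is expected to make many visits to the doubled
square: at least `r² / 16` times the number `n` of samples per unit time, times `log N`, where `r² =
1/N` (`measureReal_past_mul_le`). The total expected number of visits is `O(n r²)`, so the hitting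
probability is `O(1 / log N)`, uniformly in the mesh. Refine the mesh first, then let `N → ∞`. -/

/-! ### Estimates for one-dimensional Gaussian laws -/

/-- A Gaussian law of variance `v` gives mass at most `r / √v` to an interval of half-length `r`. -/
lemma gaussianReal_real_abs_sub_le (μ : ℝ) {v : ℝ≥0} (hv : v ≠ 0) (x : ℝ) {r : ℝ} (hr : 0 ≤ r) :
    (gaussianReal μ v).real {y | |y - x| ≤ r} ≤ r / √v := by
  have hv' : (0 : ℝ) < v := by positivity
  have hset : {y : ℝ | |y - x| ≤ r} = Set.Icc (x - r) (x + r) := by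
    ext y; simp only [Set.mem_ofPred_eq, abs_le, Set.mem_Icc]
    constructor <;> rintro ⟨h1, h2⟩ <;> constructor <;> linarith
  have hpdf : ∀ y, gaussianPDFReal μ v y ≤ (2 * √v)⁻¹ := fun y ↦ by
    rw [gaussianPDFReal]
    have h1 : 2 * √v ≤ √(2 * Real.pi * v) := by
      apply Real.le_sqrt_of_sq_le
      rw [mul_pow, Real.sq_sqrt hv'.le]
      nlinarith [Real.pi_gt_three]
    have h2 : Real.exp (-(y - μ) ^ 2 / (2 * v)) ≤ 1 := by
      rw [Real.exp_le_one_iff, neg_div]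
      exact neg_nonpos.2 (by positivity)
    calc _ ≤ (√(2 * Real.pi * v))⁻¹ * 1 := by gcongr
      _ ≤ _ := by rw [mul_one]; gcongr
  rw [measureReal_def, gaussianReal_apply_eq_integral _ hv, ENNReal.toReal_ofReal
    (integral_nonneg fun _ ↦ gaussianPDFReal_nonneg _ _ _), hset]
  calc _ ≤ ∫ _ in Set.Icc (x - r) (x + r), (2 * √v)⁻¹ :=
        setIntegral_mono (integrable_gaussianPDFReal _ _).integrableOn
          (integrableOn_const (by simp)) hpdf
    _ = r / √v := by
        simp only [integral_const, MeasurableSet.univ, measureReal_restrict_apply, Set.univ_inter,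
          Real.volume_real_Icc, smul_eq_mul]
        rw [max_eq_left (by linarith)]
        field_simp
        ring

/-- Within one standard deviation the density is at least `1 / (8√v)`, because `exp (-1/2) ≥ 1/2`
and `√(2π) ≤ 3`. -/
lemma le_gaussianReal_real_abs_lt {v : ℝ≥0} {r : ℝ} (hr : 0 < r) (hrv : r ^ 2 ≤ v) :
    r / (4 * √v) ≤ (gaussianReal 0 v).real {y | |y| < r} := by
  have hv' : (0 : ℝ) < v := lt_of_lt_of_le (by positivity) hrv
  have hv : v ≠ 0 := by rintro rfl; simp at hv'
  have hset : {y : ℝ | |y| < r} = Set.Ioo (-r) r := by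
    ext y; simp [abs_lt]
  have hpdf : ∀ y ∈ Set.Ioo (-r) r, (8 * √v)⁻¹ ≤ gaussianPDFReal 0 v y := fun y hy ↦ by
    rw [gaussianPDFReal]
    have h1 : √(2 * Real.pi * v) ≤ 3 * √v := by
      apply Real.sqrt_le_iff.2 ⟨by positivity, ?_⟩
      rw [mul_pow, Real.sq_sqrt hv'.le]
      nlinarith [Real.pi_lt_four]
    have h2 : (1 / 2 : ℝ) ≤ Real.exp (-(y - 0) ^ 2 / (2 * v)) := by
      have h3 : -(1 / 2 : ℝ) ≤ -(y - 0) ^ 2 / (2 * v) := by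
        rw [neg_div, neg_le_neg_iff, div_le_div_iff₀ (by positivity) (by positivity)]
        nlinarith [abs_lt.2 hy, sq_lt_sq' hy.1 hy.2]
      calc (1 / 2 : ℝ) ≤ -(1 / 2) + 1 := by norm_num
        _ ≤ Real.exp (-(1 / 2)) := Real.add_one_le_exp _
        _ ≤ _ := Real.exp_le_exp.2 h3
    calc (8 * √v)⁻¹ ≤ (3 * √v)⁻¹ * (1 / 2) := by
          rw [mul_inv, mul_inv]
          nlinarith [inv_pos.2 (Real.sqrt_pos.2 hv')]
      _ ≤ _ := by gcongr
  rw [measureReal_def, gaussianReal_apply_eq_integral _ hv, ENNReal.toReal_ofReal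
    (integral_nonneg fun _ ↦ gaussianPDFReal_nonneg _ _ _), hset]
  calc r / (4 * √v) = ∫ _ in Set.Ioo (-r) r, (8 * √v)⁻¹ := by
        simp only [integral_const, MeasurableSet.univ, measureReal_restrict_apply, Set.univ_inter,
          Real.volume_real_Ioo, smul_eq_mul]
        rw [max_eq_left (by linarith)]
        field_simp
        ring
    _ ≤ _ := setIntegral_mono_on (integrableOn_const (by simp))
        (integrable_gaussianPDFReal _ _).integrableOn
        measurableSet_Ioo hpdf

/-- The tails of centered Gaussian laws decay faster than any power, uniformly after scaling. -/
lemma exists_gaussianReal_real_le_abs_le (p : ℕ) (hp : p ≠ 0) :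
    ∃ C : ℝ, 0 ≤ C ∧ ∀ (c : ℝ) (v : ℝ≥0) (r : ℝ), 0 < c → (v : ℝ) = c ^ 2 → 0 < r →
      (gaussianReal 0 v).real {y | r ≤ |y|} ≤ C * (c / r) ^ p := by
  have hint : Integrable (fun y : ℝ ↦ |y| ^ p) (gaussianReal 0 1) := by
    simpa using (memLp_id_gaussianReal (μ := 0) (v := 1) (p : ℝ≥0)).integrable_norm_pow
      (by exact_mod_cast hp)
  refine ⟨∫ y, |y| ^ p ∂gaussianReal 0 1, integral_nonneg fun _ ↦ by positivity, ?_⟩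
  intro c v r hc hv hr
  have hmap : gaussianReal 0 v = (gaussianReal 0 1).map (c * ·) := by
    rw [gaussianReal_map_const_mul]
    congr 1
    · simp
    · ext; simp [hv]
  have hset : (gaussianReal 0 v).real {y | r ≤ |y|}
      = (gaussianReal 0 1).real {y | (r / c) ^ p ≤ |y| ^ p} := by
    rw [hmap, map_measureReal_apply (by fun_prop) (measurableSet_le (by fun_prop) (by fun_prop))]
    congr 1
    ext y
    simp only [Set.preimage_ofPred_eq, Set.mem_ofPred_eq, abs_mul, abs_of_pos hc]
    rw [pow_le_pow_iff_left₀ (by positivity) (by positivity) hp, div_le_iff₀' hc]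
  -- Markov's inequality for the `p`-th absolute moment of the standard Gaussian.
  have := mul_meas_ge_le_integral_of_nonneg (μ := gaussianReal 0 1)
    (Filter.Eventually.of_forall fun y : ℝ ↦ (by positivity : 0 ≤ |y| ^ p)) hint ((r / c) ^ p)
  rw [hset]
  have h3 : (c / r) ^ p * (r / c) ^ p = 1 := by
    rw [← mul_pow]; field_simp; simp
  calc _ = (c / r) ^ p * ((r / c) ^ p *
        (gaussianReal 0 1).real {y | (r / c) ^ p ≤ |y| ^ p}) := by rw [← mul_assoc, h3, one_mul]
    _ ≤ (c / r) ^ p * ∫ y, |y| ^ p ∂gaussianReal 0 1 := by gcongr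
    _ = _ := mul_comm _ _

/-! ### Independence of two pairs -/

/-- If `V₁, W₁` are independent, `V₂, W₂` are independent, and the two pairs are independent, then
`(V₁, V₂)` is independent of the events `W₁ ∈ T₁` and `W₂ ∈ T₂`. -/
lemma measureReal_inter_eq_mul_of_indepFun {Ω E₁ F₁ E₂ F₂ : Type*} [MeasurableSpace Ω]
    [MeasurableSpace E₁] [MeasurableSpace F₁] [MeasurableSpace E₂] [MeasurableSpace F₂]
    {P : Measure Ω} [IsProbabilityMeasure P] {V₁ : Ω → E₁} {W₁ : Ω → F₁} {V₂ : Ω → E₂} {W₂ : Ω → F₂}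
    (hV₁ : AEMeasurable V₁ P) (hW₁ : AEMeasurable W₁ P) (hV₂ : AEMeasurable V₂ P)
    (hW₂ : AEMeasurable W₂ P) (h₁ : IndepFun V₁ W₁ P) (h₂ : IndepFun V₂ W₂ P)
    (h : IndepFun (fun ω ↦ (V₁ ω, W₁ ω)) (fun ω ↦ (V₂ ω, W₂ ω)) P)
    {S : Set (E₁ × E₂)} {T₁ : Set F₁} {T₂ : Set F₂} (hS : MeasurableSet S)
    (hT₁ : MeasurableSet T₁) (hT₂ : MeasurableSet T₂) :
    P.real {ω | (V₁ ω, V₂ ω) ∈ S ∧ W₁ ω ∈ T₁ ∧ W₂ ω ∈ T₂}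
      = P.real {ω | (V₁ ω, V₂ ω) ∈ S} * (P.real {ω | W₁ ω ∈ T₁} * P.real {ω | W₂ ω ∈ T₂}) := by
  have : IsProbabilityMeasure (P.map V₁) := Measure.isProbabilityMeasure_map hV₁
  have : IsProbabilityMeasure (P.map V₂) := Measure.isProbabilityMeasure_map hV₂
  have : IsProbabilityMeasure (P.map W₁) := Measure.isProbabilityMeasure_map hW₁
  have : IsProbabilityMeasure (P.map W₂) := Measure.isProbabilityMeasure_map hW₂
  -- The joint law of all four variables is a product, so the claim reduces to Fubini.
  have hlaw : P.map (fun ω ↦ ((V₁ ω, W₁ ω), (V₂ ω, W₂ ω)))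
      = ((P.map V₁).prod (P.map W₁)).prod ((P.map V₂).prod (P.map W₂)) := by
    rw [(indepFun_iff_map_prod_eq_prod_map_map (hV₁.prodMk hW₁) (hV₂.prodMk hW₂)).1 h,
      (indepFun_iff_map_prod_eq_prod_map_map hV₁ hW₁).1 h₁,
      (indepFun_iff_map_prod_eq_prod_map_map hV₂ hW₂).1 h₂]
  have hV : IndepFun V₁ V₂ P := h.comp measurable_fst measurable_fst
  have hlawV : P.map (fun ω ↦ (V₁ ω, V₂ ω)) = (P.map V₁).prod (P.map V₂) :=
    (indepFun_iff_map_prod_eq_prod_map_map hV₁ hV₂).1 hV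
  let R : Set ((E₁ × F₁) × (E₂ × F₂)) := {q | (q.1.1, q.2.1) ∈ S ∧ q.1.2 ∈ T₁ ∧ q.2.2 ∈ T₂}
  have hR : MeasurableSet R :=
    (hS.preimage (by fun_prop : Measurable fun q : (E₁ × F₁) × (E₂ × F₂) ↦ (q.1.1, q.2.1))).inter
      ((hT₁.preimage (by fun_prop : Measurable fun q : (E₁ × F₁) × (E₂ × F₂) ↦ q.1.2)).inter
      (hT₂.preimage (by fun_prop : Measurable fun q : (E₁ × F₁) × (E₂ × F₂) ↦ q.2.2)))
  have key : P {ω | (V₁ ω, V₂ ω) ∈ S ∧ W₁ ω ∈ T₁ ∧ W₂ ω ∈ T₂}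
      = P {ω | (V₁ ω, V₂ ω) ∈ S} * (P {ω | W₁ ω ∈ T₁} * P {ω | W₂ ω ∈ T₂}) := by
    have e1 : P {ω | (V₁ ω, V₂ ω) ∈ S ∧ W₁ ω ∈ T₁ ∧ W₂ ω ∈ T₂}
        = P.map (fun ω ↦ ((V₁ ω, W₁ ω), (V₂ ω, W₂ ω))) R :=
      (Measure.map_apply_of_aemeasurable ((hV₁.prodMk hW₁).prodMk (hV₂.prodMk hW₂)) hR).symm
    have e2 : P {ω | (V₁ ω, V₂ ω) ∈ S} = P.map (fun ω ↦ (V₁ ω, V₂ ω)) S :=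
      (Measure.map_apply_of_aemeasurable (hV₁.prodMk hV₂) hS).symm
    have e3 : P {ω | W₁ ω ∈ T₁} = P.map W₁ T₁ := (Measure.map_apply_of_aemeasurable hW₁ hT₁).symm
    have e4 : P {ω | W₂ ω ∈ T₂} = P.map W₂ T₂ := (Measure.map_apply_of_aemeasurable hW₂ hT₂).symm
    rw [e1, e2, e3, e4, hlaw, hlawV, Measure.prod_apply hR, Measure.prod_apply hS]
    have hinner : ∀ q : E₁ × F₁, ((P.map V₂).prod (P.map W₂)) (Prod.mk q ⁻¹' R)
        = (P.map V₂) (Prod.mk q.1 ⁻¹' S) * T₁.indicator (fun _ ↦ (P.map W₂) T₂) q.2 := by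
      intro q
      by_cases hq : q.2 ∈ T₁
      · rw [Set.indicator_of_mem hq, ← Measure.prod_prod]
        congr 1
        ext z
        simp [R, hq]
      · rw [Set.indicator_of_notMem hq, mul_zero]
        convert! measure_empty (μ := (P.map V₂).prod (P.map W₂))
        ext z
        simp [R, hq]
    simp_rw [hinner]
    rw [lintegral_prod_mul (f := fun v ↦ (P.map V₂) (Prod.mk v ⁻¹' S))
      (measurable_measure_prodMk_left hS).aemeasurable
      ((measurable_const.indicator hT₁).aemeasurable), lintegral_indicator_const hT₁, mul_comm
      ((P.map W₂) T₂)]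
  simp only [measureReal_def, key, ENNReal.toReal_mul]

/-! ### Real fractional Brownian motion -/

namespace IsFractionalBrownian

variable {Ω : Type*} {mΩ : MeasurableSpace Ω} {P : Measure Ω} {B : ℝ≥0 → Ω → ℝ} {H x : ℝ}

lemma memLp_two (hB : IsFractionalBrownian B H x P) (t : ℝ≥0) : MemLp (B t) 2 P :=
  (hB.isGaussianProcess.hasGaussianLaw_eval t).memLp_two

lemma aemeasurable (hB : IsFractionalBrownian B H x P) (t : ℝ≥0) : AEMeasurable (B t) P :=
  hB.isGaussianProcess.aemeasurable t

lemma variance_eq (hB : IsFractionalBrownian B H x P) (hH : 0 < H) (t : ℝ≥0) :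
    Var[B t; P] = (t : ℝ) ^ (2 * H) := by
  rw [← covariance_self (hB.aemeasurable t), hB.covariance_eq, fbmCov, sub_self, abs_zero,
    Real.zero_rpow (by positivity)]
  ring

lemma aemeasurable_sub (hB : IsFractionalBrownian B H x P) (s t : ℝ≥0) :
    AEMeasurable (fun ω ↦ B t ω - B s ω) P :=
  (hB.aemeasurable t).sub (hB.aemeasurable s)

lemma map_eq (hB : IsFractionalBrownian B H x P) (hH : 0 < H) (t : ℝ≥0) :
    P.map (B t) = gaussianReal x (t ^ (2 * H)) := by
  rw [(hB.isGaussianProcess.hasGaussianLaw_eval t).map_eq_gaussianReal, hB.mean_eq,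
    hB.variance_eq hH, ← NNReal.coe_rpow, Real.toNNReal_coe]

lemma map_sub_eq (hB : IsFractionalBrownian B H x P) (hH : 0 < H) {s t : ℝ≥0} {h : ℝ≥0}
    (hst : (t : ℝ) - s = h) :
    P.map (fun ω ↦ B t ω - B s ω) = gaussianReal 0 (h ^ (2 * H)) := by
  have := hB.isGaussianProcess.isProbabilityMeasure
  have hvar : Var[fun ω ↦ B t ω - B s ω; P] = (h : ℝ) ^ (2 * H) := by
    change Var[B t - B s; P] = _
    rw [variance_sub (hB.memLp_two t) (hB.memLp_two s), hB.variance_eq hH, hB.variance_eq hH,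
      hB.covariance_eq, fbmCov, ← abs_neg, neg_sub, hst, abs_of_nonneg h.coe_nonneg]
    ring
  rw [hB.isGaussianProcess.hasGaussianLaw_fun_sub.map_eq_gaussianReal, hvar, integral_sub
    ((hB.memLp_two t).integrable (by norm_num)) ((hB.memLp_two s).integrable (by norm_num)),
    hB.mean_eq, hB.mean_eq, sub_self, ← NNReal.coe_rpow, Real.toNNReal_coe]

lemma measureReal_abs_sub_le (hB : IsFractionalBrownian B H x P) (hH : 0 < H) {t : ℝ≥0}
    (ht : 0 < t) (y : ℝ) {r : ℝ} (hr : 0 ≤ r) :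
    P.real {ω | |B t ω - y| ≤ r} ≤ r / (t : ℝ) ^ H := by
  have h1 : P.real {ω | |B t ω - y| ≤ r} = (P.map (B t)).real {z | |z - y| ≤ r} := by
    rw [map_measureReal_apply_of_aemeasurable (hB.aemeasurable t)
      (measurableSet_le (by fun_prop) (by fun_prop))]
    rfl
  have h2 : √((t ^ (2 * H) : ℝ≥0) : ℝ) = (t : ℝ) ^ H := by
    rw [NNReal.coe_rpow, Real.sqrt_eq_rpow, ← Real.rpow_mul t.coe_nonneg]
    congr 1
    ring
  rw [h1, hB.map_eq hH, ← h2]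
  exact gaussianReal_real_abs_sub_le _ (NNReal.rpow_pos ht).ne' _ hr

lemma le_measureReal_abs_sub_lt (hB : IsFractionalBrownian B (1 / 2) x P) {s t : ℝ≥0} {h : ℝ≥0}
    (hst : (t : ℝ) - s = h) {r : ℝ} (hr : 0 < r) (hrh : r ^ 2 ≤ h) :
    r / (4 * √h) ≤ P.real {ω | |B t ω - B s ω| < r} := by
  have h1 : P.real {ω | |B t ω - B s ω| < r}
      = (P.map (fun ω ↦ B t ω - B s ω)).real {z | |z| < r} :=
    (map_measureReal_apply_of_aemeasurable (hB.aemeasurable_sub s t)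
      (measurableSet_lt (by fun_prop) (by fun_prop) : MeasurableSet {z : ℝ | |z| < r})).symm
  rw [h1, hB.map_sub_eq (by norm_num) hst]
  simpa using le_gaussianReal_real_abs_lt hr hrh

/-- For Hurst parameter `1 / 2`, increments are independent of the past. -/
lemma indepFun_sub (hB : IsFractionalBrownian B (1 / 2) x P) {s t : ℝ≥0} (hst : s ≤ t) :
    IndepFun (fun ω (u : Set.Iic s) ↦ B u ω) (fun ω ↦ B t ω - B s ω) P := by
  have := hB.isGaussianProcess.isProbabilityMeasure
  have hG : IsGaussianProcess (Sum.elim (fun (u : Set.Iic s) ↦ B u)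
      (fun (_ : Unit) ω ↦ B t ω - B s ω)) P := by
    classical
    refine hB.isGaussianProcess.of_isGaussianProcess fun i ↦ ?_
    rcases i with u | u
    · exact ⟨{u.1}, .proj ⟨u.1, by simp⟩, fun ω ↦ rfl⟩
    · exact ⟨{s, t}, .proj ⟨t, by simp⟩ - .proj ⟨s, by simp⟩, fun ω ↦ rfl⟩
  -- Joint Gaussianity reduces independence to zero covariance; at `H = 1/2` the covariances of `B
  -- u` with `B t` and with `B s` both equal `u`.
  have hind := hG.indepFun_of_covariance_eq_zero (fun u ↦ hB.aemeasurable u)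
    (fun _ ↦ hB.aemeasurable_sub s t) (fun u _ ↦ by
      have hus : (u : ℝ) ≤ s := NNReal.coe_le_coe.2 u.2
      have hst' : (s : ℝ) ≤ t := NNReal.coe_le_coe.2 hst
      change cov[B u, B t - B s; P] = 0
      rw [covariance_sub_right (hB.memLp_two u) (hB.memLp_two t) (hB.memLp_two s),
        hB.covariance_eq, hB.covariance_eq, fbmCov, fbmCov, abs_of_nonneg (by linarith),
        abs_of_nonneg (by linarith)]
      norm_num
      ring)
  exact hind.comp measurable_id (measurable_pi_apply ())

end IsFractionalBrownian

/-! ### Small squares in the plane -/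

namespace IsPlanarFractionalBrownian

variable {Ω : Type*} {mΩ : MeasurableSpace Ω} {P : Measure Ω} {B : ℝ≥0 → Ω → ℂ} {H : ℝ} {z₀ : ℂ}

lemma isProbabilityMeasure (hB : IsPlanarFractionalBrownian B H z₀ P) : IsProbabilityMeasure P :=
  hB.re.isGaussianProcess.isProbabilityMeasure

lemma measureReal_square_le (hB : IsPlanarFractionalBrownian B H z₀ P) (hH : 0 < H) {t : ℝ≥0}
    (ht : 0 < t) (x : ℂ) {r : ℝ} (hr : 0 ≤ r) :
    P.real {ω | |(B t ω).re - x.re| ≤ r ∧ |(B t ω).im - x.im| ≤ r} ≤ (r / (t : ℝ) ^ H) ^ 2 := by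
  have hind : IndepFun (fun ω ↦ (B t ω).re) (fun ω ↦ (B t ω).im) P :=
    hB.indep.comp (measurable_pi_apply t) (measurable_pi_apply t)
  have h := hind.measure_inter_preimage_eq_mul {z | |z - x.re| ≤ r} {z | |z - x.im| ≤ r}
    (measurableSet_le (by fun_prop) (by fun_prop)) (measurableSet_le (by fun_prop) (by fun_prop))
  have h' : P.real {ω | |(B t ω).re - x.re| ≤ r ∧ |(B t ω).im - x.im| ≤ r}
      = P.real {ω | |(B t ω).re - x.re| ≤ r} * P.real {ω | |(B t ω).im - x.im| ≤ r} := by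
    simp only [measureReal_def, ← ENNReal.toReal_mul]
    exact congrArg ENNReal.toReal h
  rw [h', sq]
  gcongr
  · exact hB.re.measureReal_abs_sub_le hH ht _ hr
  · exact hB.im.measureReal_abs_sub_le hH ht _ hr

end IsPlanarFractionalBrownian

/-! ### Harmonic sums and grid approximation -/

/-- Telescoping `log ((n + 1) / n) ≤ 1 / n`. The bound is independent of `M`, which later allows the
mesh to shrink with the square fixed. -/
lemma log_le_sum_Icc_inv {N M : ℕ} (hN : 1 ≤ N) (hM : 1 ≤ M) :
    Real.log N ≤ ∑ l ∈ Finset.Icc M (N * M), (l : ℝ)⁻¹ := by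
  have hM' : (0 : ℝ) < M := by exact_mod_cast hM
  have key : ∀ n, M ≤ n → Real.log ((n + 1) / M) ≤ ∑ l ∈ Finset.Icc M n, (l : ℝ)⁻¹ := by
    have step : ∀ n : ℕ, 0 < (n : ℝ) → Real.log ((n + 1) / n) ≤ (n : ℝ)⁻¹ := fun n hn ↦ by
      have := Real.log_le_sub_one_of_pos (by positivity : 0 < ((n : ℝ) + 1) / n)
      refine this.trans (le_of_eq ?_)
      field_simp
      ring
    intro n hn
    induction n, hn using Nat.le_induction with
    | base => simpa using step M hM'
    | succ n hn ih =>
      rw [Finset.sum_Icc_succ_top (by omega)]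
      have h2 := step (n + 1) (by positivity)
      have h3 : Real.log (((n + 1 : ℕ) + 1) / M)
          = Real.log (((n : ℝ) + 1) / M) + Real.log (((n + 1 : ℕ) + 1) / (n + 1 : ℕ)) := by
        rw [← Real.log_mul (by positivity) (by positivity)]
        congr 1
        push_cast
        field_simp
      linarith
  refine le_trans ?_ (key (N * M) (Nat.le_mul_of_pos_left _ hN))
  apply Real.log_le_log (by exact_mod_cast hN)
  rw [le_div_iff₀ hM']
  push_cast
  linarith

lemma NNReal.tendsto_floor_mul_div {u : ℕ → ℝ≥0} (hu : Filter.Tendsto u Filter.atTop Filter.atTop)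
    (t : ℝ≥0) : Filter.Tendsto (fun n ↦ (⌊t * u n⌋₊ : ℝ≥0) / u n) Filter.atTop (nhds t) := by
  rw [← NNReal.tendsto_coe]
  have h := (tendsto_nat_floor_mul_div_atTop t.coe_nonneg).comp (NNReal.tendsto_coe_atTop.2 hu)
  refine h.congr fun n ↦ ?_
  simp only [Function.comp_apply, NNReal.coe_div, NNReal.coe_natCast]
  rfl

/-! ### The critical case `H = 1/2` -/

namespace IsPlanarFractionalBrownian

variable {Ω : Type*} {mΩ : MeasurableSpace Ω} {P : Measure Ω} {B : ℝ≥0 → Ω → ℂ} {H : ℝ} {z₀ : ℂ}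

/-- The real and imaginary parts of the path sampled at the times `s i`, stopped at index `k`. -/
def stoppedSamples (B : ℝ≥0 → Ω → ℂ) (s : ℕ → ℝ≥0) (k : ℕ) (ω : Ω) : (ℕ → ℝ) × (ℕ → ℝ) :=
  (fun i ↦ (B (s (min i k)) ω).re, fun i ↦ (B (s (min i k)) ω).im)

lemma aemeasurable_stoppedSamples (hB : IsPlanarFractionalBrownian B H z₀ P) (s : ℕ → ℝ≥0)
    (k : ℕ) : AEMeasurable (stoppedSamples B s k) P :=
  (aemeasurable_pi_lambda _ fun _ ↦ hB.re.aemeasurable _).prodMk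
    (aemeasurable_pi_lambda _ fun _ ↦ hB.im.aemeasurable _)

/-- Markov-type lower bound: conditionally on the past, planar Brownian motion stays within `r` of
its current position after time `h ≥ r ^ 2` with probability at least `r ^ 2 / (16 * h)`. -/
lemma measureReal_past_mul_le (hB : IsPlanarFractionalBrownian B (1 / 2) z₀ P) {s : ℕ → ℝ≥0}
    {k : ℕ} (hs : Monotone s) {t h : ℝ≥0} (hst : (t : ℝ) - s k = h) {r : ℝ} (hr : 0 < r)
    (hrh : r ^ 2 ≤ h) {S : Set ((ℕ → ℝ) × (ℕ → ℝ))} (hS : MeasurableSet S) :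
    P.real {ω | stoppedSamples B s k ω ∈ S} * (r ^ 2 / (16 * h))
      ≤ P.real {ω | stoppedSamples B s k ω ∈ S ∧ |(B t ω).re - (B (s k) ω).re| < r ∧
        |(B t ω).im - (B (s k) ω).im| < r} := by
  have := hB.isProbabilityMeasure
  have hle : s k ≤ t := by
    rw [← NNReal.coe_le_coe]; linarith [h.coe_nonneg]
  have hmin : ∀ i, s (min i k) ∈ Set.Iic (s k) := fun i ↦ hs (min_le_right i k)
  have hφ : Measurable fun (v : Set.Iic (s k) → ℝ) (i : ℕ) ↦ v ⟨s (min i k), hmin i⟩ := by fun_prop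
  have hψ : Measurable fun (v : ℝ≥0 → ℝ) ↦ ((fun i : ℕ ↦ v (s (min i k))), v t - v (s k)) := by
    fun_prop
  have hT : MeasurableSet {y : ℝ | |y| < r} := measurableSet_lt (by fun_prop) (by fun_prop)
  -- The event `S` may couple both coordinates of the past, so the one-dimensional independence
  -- statements must be combined.
  have hind := measureReal_inter_eq_mul_of_indepFun (P := P)
    (V₁ := fun ω (i : ℕ) ↦ (B (s (min i k)) ω).re) (W₁ := fun ω ↦ (B t ω).re - (B (s k) ω).re)
    (V₂ := fun ω (i : ℕ) ↦ (B (s (min i k)) ω).im) (W₂ := fun ω ↦ (B t ω).im - (B (s k) ω).im)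
    (aemeasurable_pi_lambda _ fun _ ↦ hB.re.aemeasurable _)
    (hB.re.aemeasurable_sub _ _)
    (aemeasurable_pi_lambda _ fun _ ↦ hB.im.aemeasurable _)
    (hB.im.aemeasurable_sub _ _)
    ((hB.re.indepFun_sub hle).comp hφ measurable_id)
    ((hB.im.indepFun_sub hle).comp hφ measurable_id)
    (hB.indep.comp hψ hψ) hS hT hT
  refine le_trans ?_ hind.ge
  have e : r ^ 2 / (16 * h) = r / (4 * √h) * (r / (4 * √h)) := by
    rw [div_mul_div_comm, mul_mul_mul_comm, Real.mul_self_sqrt h.coe_nonneg]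
    norm_num
    ring
  rw [e]
  have hpos : 0 ≤ r / (4 * √h) := by positivity
  exact mul_le_mul_of_nonneg_left (mul_le_mul (hB.re.le_measureReal_abs_sub_lt hst hr hrh)
    (hB.im.le_measureReal_abs_sub_lt hst hr hrh) hpos measureReal_nonneg) measureReal_nonneg

/-- Logarithmic bound on the probability that planar Brownian motion, sampled along a fine grid of
`[a, a + 1]`, visits the square of half-side `1 / √N` around `x`. -/
lemma measureReal_exists_grid_mul_log_le (hB : IsPlanarFractionalBrownian B (1 / 2) z₀ P)
    {a : ℝ≥0} (ha : 0 < a) (x : ℂ) {N M : ℕ} (hN : 1 ≤ N) (hM : 1 ≤ M) :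
    P.real {ω | ∃ i ≤ N * M, |(B (a + i / (N * M : ℕ)) ω).re - x.re| < 1 / √N ∧
      |(B (a + i / (N * M : ℕ)) ω).im - x.im| < 1 / √N} * Real.log N ≤ 192 / a := by
  have := hB.isProbabilityMeasure
  set n := N * M with hn
  set r : ℝ := 1 / √N with hr
  have hN' : (0 : ℝ) < N := by exact_mod_cast hN
  have hM' : (0 : ℝ) < M := by exact_mod_cast hM
  have hn1 : 1 ≤ n := Nat.mul_pos hN hM
  have hn' : (0 : ℝ) < n := by exact_mod_cast hn1
  have hr0 : 0 < r := by positivity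
  have hr2 : r ^ 2 = 1 / N := by rw [hr, div_pow, Real.sq_sqrt hN'.le, one_pow]
  let s : ℕ → ℝ≥0 := fun i ↦ a + i / n
  have hs : Monotone s := fun i j hij ↦ by
    have : (i : ℝ≥0) ≤ j := by exact_mod_cast hij
    simp only [s]
    gcongr
  let F' : ℕ → Set ((ℕ → ℝ) × (ℕ → ℝ)) := fun i ↦ {p | |p.1 i - x.re| < r ∧ |p.2 i - x.im| < r}
  have hF' : ∀ i, MeasurableSet (F' i) := fun i ↦
    .inter (measurableSet_lt (by fun_prop) (by fun_prop) :
        MeasurableSet {p : (ℕ → ℝ) × (ℕ → ℝ) | |p.1 i - x.re| < r})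
      (measurableSet_lt (by fun_prop) (by fun_prop) :
        MeasurableSet {p : (ℕ → ℝ) × (ℕ → ℝ) | |p.2 i - x.im| < r})
  -- First entrance at index `k`: it depends only on samples up to `k`, and the resulting events `A
  -- k` are disjoint.
  let S : ℕ → Set ((ℕ → ℝ) × (ℕ → ℝ)) := fun k ↦ F' k \ ⋃ i ∈ Finset.range k, F' i
  have hS : ∀ k, MeasurableSet (S k) := fun k ↦
    (hF' k).diff (Finset.measurableSet_biUnion _ fun i _ ↦ hF' i)
  let F : ℕ → Set Ω := fun i ↦ {ω | |(B (s i) ω).re - x.re| < r ∧ |(B (s i) ω).im - x.im| < r}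
  let A : ℕ → Set Ω := fun k ↦ {ω | stoppedSamples B s k ω ∈ S k}
  have hA_iff : ∀ k ω, ω ∈ A k ↔ ω ∈ F k ∧ ∀ i < k, ω ∉ F i := fun k ω ↦ by
    have h1 : ∀ i ≤ k, (stoppedSamples B s k ω ∈ F' i ↔ ω ∈ F i) := fun i hi ↦ by
      change (|(B (s (min i k)) ω).re - x.re| < r ∧ |(B (s (min i k)) ω).im - x.im| < r) ↔ _
      rw [min_eq_left hi]
      rfl
    change stoppedSamples B s k ω ∈ F' k \ ⋃ i ∈ Finset.range k, F' i ↔ _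
    simp only [Set.mem_sdiff, Set.mem_iUnion, Finset.mem_range, not_exists, h1 k le_rfl]
    refine and_congr_right fun _ ↦ forall₂_congr fun i hi ↦ by rw [h1 i hi.le]
  have hA_meas : ∀ k, NullMeasurableSet (A k) P := fun k ↦
    (hB.aemeasurable_stoppedSamples s k).nullMeasurableSet_preimage (hS k)
  have hA_disj : Pairwise (Function.onFun Disjoint A) := by
    intro i j hij
    rw [Function.onFun, Set.disjoint_left]
    intro ω hi hj
    rw [hA_iff] at hi hj
    rcases lt_or_gt_of_ne hij with h | h
    · exact hj.2 i h hi.1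
    · exact hi.2 j h hj.1
  -- Doubled square: a position within `r` of `x`, followed by an increment below `r`, ends here.
  let E : ℕ → Set Ω := fun j ↦
    {ω | |(B (s j) ω).re - x.re| ≤ 2 * r ∧ |(B (s j) ω).im - x.im| ≤ 2 * r}
  have hE_meas : ∀ j, NullMeasurableSet (E j) P := fun j ↦ by
    refine NullMeasurableSet.inter ?_ ?_
    · exact (hB.re.aemeasurable (s j)).nullMeasurableSet_preimage
        (measurableSet_le (by fun_prop) (by fun_prop) : MeasurableSet {y : ℝ | |y - x.re| ≤ 2 * r})
    · exact (hB.im.aemeasurable (s j)).nullMeasurableSet_preimage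
        (measurableSet_le (by fun_prop) (by fun_prop) : MeasurableSet {y : ℝ | |y - x.im| ≤ 2 * r})
  have hE : ∀ j, P.real (E j) ≤ 4 * r ^ 2 / a := fun j ↦ by
    have hsj : 0 < s j := lt_of_lt_of_le ha le_self_add
    refine (hB.measureReal_square_le (by norm_num) hsj x (by positivity)).trans ?_
    rw [div_pow, ← Real.sqrt_eq_rpow, Real.sq_sqrt (s j).coe_nonneg]
    have : (a : ℝ) ≤ s j := NNReal.coe_le_coe.2 le_self_add
    have ha' : (0 : ℝ) < a := ha
    calc (2 * r) ^ 2 / (s j : ℝ) ≤ (2 * r) ^ 2 / a := by gcongr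
      _ = _ := by ring
  -- The restriction `l ≥ M` is exactly `r² = 1/N ≤ l/n`, as the Markov lower bound requires.
  have hstep : ∀ k, ∀ l ∈ Finset.Icc M n,
      P.real (A k) * (r ^ 2 * n / 16 * (l : ℝ)⁻¹) ≤ P.real (A k ∩ E (k + l)) := by
    intro k l hl
    rw [Finset.mem_Icc] at hl
    have hl0 : (0 : ℝ) < l := by exact_mod_cast lt_of_lt_of_le hM hl.1
    have hMl : (M : ℝ) ≤ l := by exact_mod_cast hl.1
    have h1 : ((s (k + l) : ℝ≥0) : ℝ) - s k = ((l / n : ℝ≥0) : ℝ) := by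
      simp only [s]
      push_cast
      ring
    have h2 : r ^ 2 ≤ ((l / n : ℝ≥0) : ℝ) := by
      rw [hr2]
      push_cast
      rw [div_le_div_iff₀ hN' hn', hn]
      push_cast
      nlinarith
    have h3 := hB.measureReal_past_mul_le hs h1 hr0 h2 (hS k)
    have e : r ^ 2 * n / 16 * (l : ℝ)⁻¹ = r ^ 2 / (16 * ((l / n : ℝ≥0) : ℝ)) := by
      push_cast
      field_simp
    rw [e]
    refine h3.trans (measureReal_mono ?_)
    rintro ω ⟨hωA, h4, h5⟩
    refine ⟨hωA, ?_⟩
    obtain ⟨⟨h6, h7⟩, -⟩ := (hA_iff k ω).1 hωA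
    rw [abs_lt] at h4 h5 h6 h7
    constructor <;> rw [abs_le] <;> constructor <;> linarith
  have hinner : ∀ k ∈ Finset.range (n + 1), ∑ l ∈ Finset.Icc M n, P.real (A k ∩ E (k + l))
      ≤ ∑ j ∈ Finset.range (2 * n + 1), P.real (A k ∩ E j) := by
    intro k hk
    rw [← Finset.sum_image (f := fun j ↦ P.real (A k ∩ E j)) (g := fun l ↦ k + l)
      (fun _ _ _ _ h ↦ by simpa using h)]
    refine Finset.sum_le_sum_of_subset_of_nonneg ?_ fun _ _ _ ↦ measureReal_nonneg
    intro j hj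
    simp only [Finset.mem_image, Finset.mem_Icc, Finset.mem_range] at hj hk ⊢
    omega
  have houter : ∀ j, ∑ k ∈ Finset.range (n + 1), P.real (A k ∩ E j) ≤ P.real (E j) := by
    intro j
    rw [← measureReal_biUnion_finset₀]
    · exact measureReal_mono (Set.iUnion₂_subset fun _ _ ↦ Set.inter_subset_right)
    · intro i _ k _ hik
      exact ((hA_disj hik).mono Set.inter_subset_left Set.inter_subset_left).aedisjoint
    · exact fun k _ ↦ (hA_meas k).inter (hE_meas j)
  have hcover : {ω | ∃ i ≤ n, |(B (a + i / (n : ℕ)) ω).re - x.re| < r ∧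
      |(B (a + i / (n : ℕ)) ω).im - x.im| < r} ⊆ ⋃ k ∈ Finset.range (n + 1), A k := by
    rintro ω ⟨i, hi, hωi⟩
    classical
    have hex : ∃ i, ω ∈ F i := ⟨i, hωi⟩
    refine Set.mem_biUnion (x := Nat.find hex) ?_ ?_
    · have := Nat.find_min' hex hωi
      simp only [Finset.coe_range, Set.mem_Iio]
      omega
    · exact (hA_iff _ _).2 ⟨Nat.find_spec hex, fun j hj ↦ Nat.find_min hex hj⟩
  set p := P.real {ω | ∃ i ≤ n, |(B (a + i / (n : ℕ)) ω).re - x.re| < r ∧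
      |(B (a + i / (n : ℕ)) ω).im - x.im| < r}
  have hp : p ≤ ∑ k ∈ Finset.range (n + 1), P.real (A k) :=
    (measureReal_mono hcover (measure_ne_top _ _)).trans (measureReal_biUnion_finset_le _ _)
  have hlog : Real.log N ≤ ∑ l ∈ Finset.Icc M n, (l : ℝ)⁻¹ := log_le_sum_Icc_inv hN hM
  -- The expected number of visits to the doubled square, bounded below through the first entrance
  -- and above by summing one-point probabilities.
  have hmain : p * (r ^ 2 * n / 16 * Real.log N) ≤ (2 * n + 1) * (4 * r ^ 2 / a) :=
    calc p * (r ^ 2 * n / 16 * Real.log N)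
        ≤ (∑ k ∈ Finset.range (n + 1), P.real (A k)) *
          (r ^ 2 * n / 16 * ∑ l ∈ Finset.Icc M n, (l : ℝ)⁻¹) := by
          have := Real.log_natCast_nonneg N
          gcongr
      _ = ∑ k ∈ Finset.range (n + 1), ∑ l ∈ Finset.Icc M n,
            P.real (A k) * (r ^ 2 * n / 16 * (l : ℝ)⁻¹) := by
          rw [Finset.mul_sum, Finset.sum_mul_sum]
      _ ≤ ∑ k ∈ Finset.range (n + 1), ∑ j ∈ Finset.range (2 * n + 1), P.real (A k ∩ E j) :=
          Finset.sum_le_sum fun k hk ↦ (Finset.sum_le_sum (hstep k)).trans (hinner k hk)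
      _ = ∑ j ∈ Finset.range (2 * n + 1), ∑ k ∈ Finset.range (n + 1), P.real (A k ∩ E j) :=
          Finset.sum_comm
      _ ≤ ∑ j ∈ Finset.range (2 * n + 1), 4 * r ^ 2 / (a : ℝ) :=
          Finset.sum_le_sum fun j _ ↦ (houter j).trans (hE j)
      _ = (2 * n + 1) * (4 * r ^ 2 / a) := by simp
  have ha' : (0 : ℝ) < a := ha
  have hn1' : (1 : ℝ) ≤ n := by exact_mod_cast hn1
  have hfin : (r ^ 2 * n / 16) * (p * Real.log N) ≤ (r ^ 2 * n / 16) * (192 / a) :=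
    calc _ = p * (r ^ 2 * n / 16 * Real.log N) := by ring
      _ ≤ (2 * n + 1) * (4 * r ^ 2 / a) := hmain
      _ ≤ (3 * n) * (4 * r ^ 2 / a) := by gcongr; linarith
      _ = _ := by ring
  exact le_of_mul_le_mul_left hfin (by positivity)

/-- Planar Brownian motion does not visit `x` during `[a, a + 1]`. -/
lemma measure_exists_mem_Icc_eq_zero (hB : IsPlanarFractionalBrownian B (1 / 2) z₀ P)
    {a : ℝ≥0} (ha : 0 < a) (x : ℂ) :
    P {ω | ∃ t, a ≤ t ∧ t ≤ a + 1 ∧ B t ω = x} = 0 := by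
  have := hB.isProbabilityMeasure
  have hbound : ∀ N : ℕ, 2 ≤ N → P {ω | ∃ t, a ≤ t ∧ t ≤ a + 1 ∧ B t ω = x}
      ≤ ENNReal.ofReal (192 / a / Real.log N) := by
    intro N hN
    have hlog : 0 < Real.log N := Real.log_pos (by exact_mod_cast hN)
    let D : ℕ → Set Ω := fun M ↦ {ω | ∃ i ≤ N * (M + 1),
      |(B (a + i / (N * (M + 1) : ℕ)) ω).re - x.re| < 1 / √N ∧
      |(B (a + i / (N * (M + 1) : ℕ)) ω).im - x.im| < 1 / √N}
    have hD : ∀ M, P (D M) ≤ ENNReal.ofReal (192 / a / Real.log N) := fun M ↦ by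
      rw [← ENNReal.ofReal_toReal (measure_ne_top P (D M))]
      refine ENNReal.ofReal_le_ofReal ((le_div_iff₀ hlog).2 ?_)
      exact hB.measureReal_exists_grid_mul_log_le ha x (by omega) (by omega)
    -- The union of the `G M'` is the lower limit of the `D M`. By continuity a path hitting `x`
    -- lies in all `D M` with `M` large, and the bound on `D M` does not depend on `M`.
    let G : ℕ → Set Ω := fun M' ↦ ⋂ M ≥ M', D M
    have hG : Monotone G := fun i j hij ↦ Set.biInter_subset_biInter_left fun M hM ↦ hij.trans hM
    have hGle : P (⋃ M', G M') ≤ ENNReal.ofReal (192 / a / Real.log N) := by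
      rw [hG.measure_iUnion]
      exact iSup_le fun M' ↦ (measure_mono (Set.biInter_subset_of_mem le_rfl)).trans (hD M')
    refine le_trans (measure_mono_ae ?_) hGle
    filter_upwards [hB.re.continuous_paths, hB.im.continuous_paths] with ω hre him
    rintro ⟨t, hat, hta, htx⟩
    let u : ℕ → ℝ≥0 := fun M ↦ a + ⌊(t - a) * (N * (M + 1) : ℕ)⌋₊ / (N * (M + 1) : ℕ)
    have hu : Filter.Tendsto u Filter.atTop (nhds t) := by
      have h1 : Filter.Tendsto (fun M : ℕ ↦ ((N * (M + 1) : ℕ) : ℝ≥0)) Filter.atTop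
          Filter.atTop := by
        refine tendsto_natCast_atTop_atTop.comp (Filter.tendsto_atTop_mono (fun M ↦ ?_)
          Filter.tendsto_id)
        simp only [id]
        nlinarith
      have h2 := NNReal.tendsto_floor_mul_div h1 (t - a)
      have h3 := h2.const_add a
      rwa [add_tsub_cancel_of_le hat] at h3
    have hpos : 0 < 1 / √(N : ℝ) := by
      have : (0 : ℝ) < N := by exact_mod_cast (by omega : 0 < N)
      positivity
    have e1 : ∀ᶠ M in Filter.atTop, |(B (u M) ω).re - x.re| < 1 / √N := by
      have := ((hre.tendsto t).comp hu).eventually (Metric.ball_mem_nhds _ hpos)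
      simpa [htx, Real.dist_eq] using this
    have e2 : ∀ᶠ M in Filter.atTop, |(B (u M) ω).im - x.im| < 1 / √N := by
      have := ((him.tendsto t).comp hu).eventually (Metric.ball_mem_nhds _ hpos)
      simpa [htx, Real.dist_eq] using this
    obtain ⟨M', hM'⟩ := Filter.eventually_atTop.1 (e1.and e2)
    refine Set.mem_iUnion.2 ⟨M', Set.mem_iInter₂.2 fun M hM ↦ ⟨_, ?_, hM' M hM⟩⟩
    have h1 : t - a ≤ 1 := by rwa [tsub_le_iff_left]
    exact Nat.floor_le_of_le (mul_le_of_le_one_left zero_le h1)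
  have hlim : Filter.Tendsto (fun N : ℕ ↦ ENNReal.ofReal (192 / a / Real.log N)) Filter.atTop
      (nhds 0) := by
    rw [← ENNReal.ofReal_zero]
    exact ENNReal.tendsto_ofReal ((Real.tendsto_log_atTop.comp
      tendsto_natCast_atTop_atTop).const_div_atTop _)
  exact le_antisymm (ge_of_tendsto hlim ((Filter.eventually_ge_atTop 2).mono hbound)) bot_le

end IsPlanarFractionalBrownian

/-! ### The case `H > 1/2`: dyadic chaining and covering -/

/-- Dyadic chaining: geometric control of dyadic increments gives control of the distance to the
preceding dyadic point. -/
lemma abs_sub_floor_le_of_dyadic {f : ℝ≥0 → ℝ} (hf : Continuous f) {T M : ℕ} {r : ℝ} (hr0 : 0 ≤ r)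
    (hr1 : r < 1)
    (h : ∀ m ≥ M, ∀ k < T * 2 ^ m, |f ((k + 1 : ℕ) / 2 ^ m) - f ((k : ℕ) / 2 ^ m)| ≤ r ^ m)
    {m : ℕ} (hm : M ≤ m) {t : ℝ≥0} (ht : t < T) :
    |f t - f (⌊t * 2 ^ m⌋₊ / 2 ^ m)| ≤ r ^ m / (1 - r) := by
  let g : ℕ → ℝ := fun j ↦ f (⌊t * 2 ^ (m + j)⌋₊ / 2 ^ (m + j))
  have hg : Filter.Tendsto g Filter.atTop (nhds (f t)) := by
    have h1 : Filter.Tendsto (fun j : ℕ ↦ (2 : ℝ≥0) ^ (m + j)) Filter.atTop Filter.atTop := by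
      have := (tendsto_pow_atTop_atTop_of_one_lt (one_lt_two (α := ℝ≥0))).comp
        (Filter.tendsto_add_atTop_nat m)
      simpa [Function.comp_def, add_comm] using this
    exact (hf.tendsto t).comp (NNReal.tendsto_floor_mul_div h1 t)
  have hstep : ∀ j, dist (g j) (g (j + 1)) ≤ r ^ m * r ^ j := by
    intro j
    set K := ⌊t * 2 ^ (m + j)⌋₊ with hK
    set K' := ⌊t * 2 ^ (m + (j + 1))⌋₊ with hK'
    have e : t * 2 ^ (m + (j + 1)) = t * 2 ^ (m + j) * 2 := by ring
    have hK1 : (K : ℝ≥0) ≤ t * 2 ^ (m + j) := Nat.floor_le zero_le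
    have hK2 : t * 2 ^ (m + j) < K + 1 := Nat.lt_floor_add_one _
    have hlow : 2 * K ≤ K' := by
      apply Nat.le_floor
      rw [e]
      push_cast
      rw [mul_comm]
      gcongr
    have hup : K' < 2 * K + 2 := by
      rw [hK', Nat.floor_lt zero_le, e]
      push_cast
      calc t * 2 ^ (m + j) * 2 < (K + 1) * 2 := by gcongr
        _ = _ := by ring
    have hK'T : K' < T * 2 ^ (m + (j + 1)) := by
      rw [hK', Nat.floor_lt zero_le]
      push_cast
      gcongr
    have hKeq : ((K : ℝ≥0)) / 2 ^ (m + j) = ((2 * K : ℕ) : ℝ≥0) / 2 ^ (m + (j + 1)) := by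
      push_cast
      rw [← add_assoc, pow_succ, mul_comm (2 : ℝ≥0) K, mul_div_mul_right _ _ two_ne_zero]
    have hrr : r ^ (m + (j + 1)) ≤ r ^ m * r ^ j := by
      rw [← pow_add]
      exact pow_le_pow_of_le_one hr0 hr1.le (by omega)
    change |f (K / 2 ^ (m + j)) - f (K' / 2 ^ (m + (j + 1)))| ≤ _
    rw [hKeq]
    -- Successive dyadic approximations of `t` coincide or are neighbours at the finer level.
    rcases (by omega : K' = 2 * K ∨ K' = 2 * K + 1) with h2 | h2
    · rw [h2, sub_self, abs_zero]
      positivity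
    · rw [h2, abs_sub_comm]
      exact (h _ (by omega) (2 * K) (by omega)).trans hrr
  have := dist_le_of_le_geometric_of_tendsto₀ r (r ^ m) hr1 hstep hg
  rw [dist_comm, Real.dist_eq] at this
  simpa [g] using this

/-- Almost surely, dyadic increments of fractional Brownian motion at scale `2⁻ᵐ` are eventually
at most `r ^ m`, for any `r > 2 ^ (-H)`. -/
lemma IsFractionalBrownian.ae_eventually_dyadic_le {Ω : Type*} {mΩ : MeasurableSpace Ω}
    {P : Measure Ω} {B : ℝ≥0 → Ω → ℝ} {H x : ℝ} (hB : IsFractionalBrownian B H x P) (hH : 0 < H)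
    (T : ℕ) {r : ℝ} (hr : (2 : ℝ) ^ (-H) < r) :
    ∀ᵐ ω ∂P, ∃ M : ℕ, ∀ m ≥ M, ∀ k < T * 2 ^ m,
      |B ((k + 1 : ℕ) / 2 ^ m) ω - B ((k : ℕ) / 2 ^ m) ω| ≤ r ^ m := by
  have := hB.isGaussianProcess.isProbabilityMeasure
  have h2H : (0 : ℝ) < 2 ^ (-H) := by positivity
  have hr0 : 0 < r := h2H.trans hr
  -- The moment `p` is large enough that the tail bound beats the `2^m` increments per unit time,
  -- giving a ratio `q < 1` for Borel–Cantelli.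
  obtain ⟨p, hp⟩ := exists_pow_lt_of_lt_one (by norm_num : (0 : ℝ) < 1 / 2)
    ((div_lt_one hr0).2 hr)
  have hp0 : p ≠ 0 := by rintro rfl; norm_num at hp
  obtain ⟨C, hC0, hC⟩ := exists_gaussianReal_real_le_abs_le p hp0
  set q : ℝ := 2 * ((2 : ℝ) ^ (-H) / r) ^ p with hq
  have hq0 : 0 ≤ q := by positivity
  have hq1 : q < 1 := by linarith
  let bad : ℕ → Set Ω := fun m ↦ ⋃ k ∈ Finset.range (T * 2 ^ m),
    {ω | r ^ m ≤ |B ((k + 1 : ℕ) / 2 ^ m) ω - B ((k : ℕ) / 2 ^ m) ω|}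
  have hone : ∀ m k : ℕ, P.real {ω | r ^ m ≤ |B ((k + 1 : ℕ) / 2 ^ m) ω - B ((k : ℕ) / 2 ^ m) ω|}
      ≤ C * ((2 : ℝ) ^ (-H) / r) ^ (p * m) := by
    intro m k
    have hst : (((k + 1 : ℕ) / 2 ^ m : ℝ≥0) : ℝ) - ((k : ℕ) / 2 ^ m : ℝ≥0)
        = ((1 / 2 ^ m : ℝ≥0) : ℝ) := by
      push_cast
      ring
    have e1 : P.real {ω | r ^ m ≤ |B ((k + 1 : ℕ) / 2 ^ m) ω - B ((k : ℕ) / 2 ^ m) ω|}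
        = (P.map (fun ω ↦ B ((k + 1 : ℕ) / 2 ^ m) ω - B ((k : ℕ) / 2 ^ m) ω)).real
          {z | r ^ m ≤ |z|} :=
      (map_measureReal_apply_of_aemeasurable (hB.aemeasurable_sub _ _)
        (measurableSet_le (by fun_prop) (by fun_prop) : MeasurableSet {z : ℝ | r ^ m ≤ |z|})).symm
    rw [e1, hB.map_sub_eq hH hst]
    refine (hC (((2 : ℝ) ^ (-H)) ^ m) _ (r ^ m) (by positivity) ?_ (by positivity)).trans ?_
    · push_cast
      rw [one_div, Real.inv_rpow (by positivity), ← Real.rpow_neg (by positivity), ← pow_mul,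
        ← Real.rpow_natCast, ← Real.rpow_natCast, ← Real.rpow_mul (by norm_num),
        ← Real.rpow_mul (by norm_num)]
      congr 1
      push_cast
      ring
    · rw [← div_pow, ← pow_mul, mul_comm m p]
  have hbad : ∀ m, P (bad m) ≤ ENNReal.ofReal (T * C * q ^ m) := fun m ↦ by
    rw [← ENNReal.ofReal_toReal (measure_ne_top P (bad m))]
    refine ENNReal.ofReal_le_ofReal ?_
    calc P.real (bad m) ≤ ∑ k ∈ Finset.range (T * 2 ^ m), C * ((2 : ℝ) ^ (-H) / r) ^ (p * m) :=
          (measureReal_biUnion_finset_le _ _).trans (Finset.sum_le_sum fun k _ ↦ hone m k)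
      _ = T * C * q ^ m := by
          rw [Finset.sum_const, Finset.card_range, nsmul_eq_mul, hq, mul_pow, ← pow_mul]
          push_cast
          ring
  have hsum : ∑' m, P (bad m) ≠ ⊤ := by
    refine ne_top_of_le_ne_top ?_ (ENNReal.tsum_le_tsum hbad)
    have hs : Summable fun m : ℕ ↦ T * C * q ^ m := (summable_geometric_of_lt_one hq0 hq1).mul_left _
    rw [← ENNReal.ofReal_tsum_of_nonneg (fun m ↦ by positivity) hs]
    exact ENNReal.ofReal_ne_top
  filter_upwards [ae_eventually_notMem hsum] with ω hω
  obtain ⟨M, hM⟩ := Filter.eventually_atTop.1 hω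
  refine ⟨M, fun m hm k hk ↦ ?_⟩
  by_contra hlt
  exact hM m hm (Set.mem_biUnion (x := k) (by simpa using hk) (not_le.1 hlt).le)

/-- For Hurst parameter larger than `1 / 2`, planar fractional Brownian motion does not visit `x`
during `[a, T)`. -/
lemma IsPlanarFractionalBrownian.measure_exists_mem_Ico_eq_zero {Ω : Type*}
    {mΩ : MeasurableSpace Ω} {P : Measure Ω} {B : ℝ≥0 → Ω → ℂ} {H : ℝ} {z₀ : ℂ}
    (hB : IsPlanarFractionalBrownian B H z₀ P) (hH : 1 / 2 < H) {a : ℝ≥0} (ha : 0 < a) (T : ℕ)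
    (x : ℂ) : P {ω | ∃ t, a ≤ t ∧ t < T ∧ B t ω = x} = 0 := by
  have := hB.isProbabilityMeasure
  have hH0 : 0 < H := by linarith
  -- `θ < H` lets `r^m` dominate the dyadic increments; `θ > 1/2` gives `2r² < 1`.
  obtain ⟨θ, hθ1, hθ2⟩ := exists_between hH
  set r : ℝ := 2 ^ (-θ) with hr
  have hr0 : 0 < r := by positivity
  have hr1 : r < 1 := Real.rpow_lt_one_of_one_lt_of_neg (by norm_num) (by linarith)
  have hHr : (2 : ℝ) ^ (-H) < r := Real.rpow_lt_rpow_of_exponent_lt (by norm_num) (by linarith)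
  have hr2 : 2 * r ^ 2 < 1 := by
    have e : 2 * r ^ 2 = (2 : ℝ) ^ (1 + -θ * 2) := by
      rw [Real.rpow_add (by norm_num), Real.rpow_mul (by norm_num), Real.rpow_one, hr]
      norm_num
    rw [e]
    exact Real.rpow_lt_one_of_one_lt_of_neg (by norm_num) (by linarith)
  let d : ℕ → ℝ≥0 → ℝ≥0 := fun m t ↦ ⌊t * 2 ^ m⌋₊ / 2 ^ m
  let U : ℕ → Set Ω := fun M ↦ {ω | (∃ t, a ≤ t ∧ t < T ∧ B t ω = x) ∧ ∀ m ≥ M, ∀ t : ℝ≥0, t < T →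
    |(B t ω).re - (B (d m t) ω).re| ≤ r ^ m / (1 - r) ∧
    |(B t ω).im - (B (d m t) ω).im| ≤ r ^ m / (1 - r)}
  have hU : ∀ M, P (U M) = 0 := by
    intro M
    set c : ℝ := (1 / (1 - r) / ((a : ℝ) / 2) ^ H) ^ 2
    -- The condition `2 / a ≤ 2^m` keeps the dyadic point preceding `t ≥ a` above `a / 2`, where the
    -- variance is bounded below.
    have hbound : ∀ m, M ≤ m → 2 / (a : ℝ) ≤ 2 ^ m → P.real (U M) ≤ T * c * (2 * r ^ 2) ^ m := by
      intro m hm ham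
      have ha' : (0 : ℝ) < a := ha
      have h1r : 0 < 1 - r := by linarith
      let I := (Finset.range (T * 2 ^ m)).filter fun k : ℕ ↦ (a : ℝ) / 2 ≤ k / 2 ^ m
      have hsub : U M ⊆ ⋃ k ∈ I, {ω | |(B ((k : ℕ) / 2 ^ m) ω).re - x.re| ≤ r ^ m / (1 - r) ∧
          |(B ((k : ℕ) / 2 ^ m) ω).im - x.im| ≤ r ^ m / (1 - r)} := by
        rintro ω ⟨⟨t, hat, htT, htx⟩, hω⟩
        refine Set.mem_biUnion (x := ⌊t * 2 ^ m⌋₊) ?_ ?_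
        · simp only [I, Finset.coe_filter, Finset.mem_range, Set.mem_ofPred_eq]
          refine ⟨?_, ?_⟩
          · rw [Nat.floor_lt zero_le]
            push_cast
            gcongr
          · have h1 : t * 2 ^ m < ⌊t * 2 ^ m⌋₊ + 1 := Nat.lt_floor_add_one _
            have h2 : (t : ℝ) * 2 ^ m < ⌊t * 2 ^ m⌋₊ + 1 := by exact_mod_cast h1
            have h3 : (a : ℝ) ≤ t := NNReal.coe_le_coe.2 hat
            rw [le_div_iff₀ (by positivity)]
            rw [div_le_iff₀ ha'] at ham
            nlinarith [mul_le_mul_of_nonneg_right h3 (by positivity : (0 : ℝ) ≤ 2 ^ m)]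
        · have h1 := hω m hm t htT
          rw [htx, abs_sub_comm, abs_sub_comm x.im] at h1
          exact h1
      calc P.real (U M) ≤ ∑ k ∈ I, (r ^ m / (1 - r) / ((a : ℝ) / 2) ^ H) ^ 2 := by
            refine (measureReal_mono hsub (measure_ne_top _ _)).trans ((measureReal_biUnion_finset_le _ _).trans
              (Finset.sum_le_sum fun k hk ↦ ?_))
            have hk' : (a : ℝ) / 2 ≤ ((k / 2 ^ m : ℝ≥0) : ℝ) := by
              push_cast
              exact (Finset.mem_filter.1 hk).2
            have hk0 : 0 < (k / 2 ^ m : ℝ≥0) := by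
              rw [← NNReal.coe_pos]
              linarith
            refine (hB.measureReal_square_le hH0 hk0 x (by positivity)).trans ?_
            gcongr
        _ ≤ (T * 2 ^ m : ℕ) * (r ^ m / (1 - r) / ((a : ℝ) / 2) ^ H) ^ 2 := by
            rw [Finset.sum_const, nsmul_eq_mul]
            gcongr
            exact (Finset.card_filter_le _ _).trans (Finset.card_range _).le
        _ = T * c * (2 * r ^ 2) ^ m := by
            simp only [c]
            push_cast
            ring
    have hlim : Filter.Tendsto (fun m : ℕ ↦ T * c * (2 * r ^ 2) ^ m) Filter.atTop (nhds 0) := by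
      simpa using (tendsto_pow_atTop_nhds_zero_of_lt_one (by positivity) hr2).const_mul (T * c)
    have hle : P.real (U M) ≤ 0 := by
      refine ge_of_tendsto hlim ?_
      filter_upwards [Filter.eventually_ge_atTop M, (tendsto_pow_atTop_atTop_of_one_lt
        (one_lt_two (α := ℝ))).eventually_ge_atTop (2 / (a : ℝ))] with m h1 h2 using hbound m h1 h2
    exact (measureReal_eq_zero_iff).1 (le_antisymm hle measureReal_nonneg)
  refine measure_mono_null_ae ?_ (measure_iUnion_null hU)
  filter_upwards [hB.re.continuous_paths, hB.im.continuous_paths,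
    hB.re.ae_eventually_dyadic_le hH0 T hHr, hB.im.ae_eventually_dyadic_le hH0 T hHr]
    with ω hre him ⟨M₁, h₁⟩ ⟨M₂, h₂⟩ hω
  refine Set.mem_iUnion.2 ⟨max M₁ M₂, hω, fun m hm t ht ↦ ⟨?_, ?_⟩⟩
  · exact abs_sub_floor_le_of_dyadic hre hr0.le hr1 h₁ (le_of_max_le_left hm) ht
  · exact abs_sub_floor_le_of_dyadic him hr0.le hr1 h₂ (le_of_max_le_right hm) ht

/-! ### Countable covers of the positive times -/

theorem proposition9 {Ω : Type*} [MeasurableSpace Ω] (P : Measure Ω) [IsProbabilityMeasure P]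
    (H : ℝ) (hH : 1 / 2 ≤ H) (hH1 : H < 1) (z₀ : ℂ) (B : ℝ≥0 → Ω → ℂ)
    (hB : IsPlanarFractionalBrownian B H z₀ P) (x : ℂ) :
    P {ω | ∃ t : ℝ≥0, 0 < t ∧ B t ω = x} = 0 := by
  rcases hH.eq_or_lt with rfl | hH
  · refine measure_mono_null (t := ⋃ q : ℕ × ℕ, {ω | ∃ t : ℝ≥0,
      q.1 + 1 / (q.2 + 1) ≤ t ∧ t ≤ q.1 + 1 / (q.2 + 1) + 1 ∧ B t ω = x}) ?_
      (measure_iUnion_null fun q ↦ hB.measure_exists_mem_Icc_eq_zero (by positivity) x)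
    rintro ω ⟨t, ht, htx⟩
    obtain ⟨n, hn⟩ := exists_nat_one_div_lt ht
    rcases le_or_gt t 1 with h | h
    · exact Set.mem_iUnion.2 ⟨(0, n), t, by simpa using hn.le, by simpa using h.trans le_add_self, htx⟩
    · have hlt := Nat.lt_floor_add_one t
      have h1 : 1 ≤ ⌊t⌋₊ := Nat.le_floor (by simpa using h.le)
      -- Second index `0` contributes an offset of `1`, so the interval is `[⌊t⌋, ⌊t⌋ + 1]`.
      refine Set.mem_iUnion.2 ⟨(⌊t⌋₊ - 1, 0), t, ?_, ?_, htx⟩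
      · simpa [Nat.cast_sub h1, tsub_add_cancel_of_le (Nat.one_le_cast.2 h1 : (1 : ℝ≥0) ≤ ⌊t⌋₊)]
          using Nat.floor_le (zero_le : 0 ≤ t)
      · simpa [Nat.cast_sub h1, tsub_add_cancel_of_le (Nat.one_le_cast.2 h1 : (1 : ℝ≥0) ≤ ⌊t⌋₊)]
          using hlt.le
  · refine measure_mono_null (t := ⋃ q : ℕ × ℕ, {ω | ∃ t : ℝ≥0,
      1 / ((q.1 : ℝ≥0) + 1) ≤ t ∧ t < q.2 ∧ B t ω = x}) ?_
      (measure_iUnion_null fun q ↦ hB.measure_exists_mem_Ico_eq_zero hH (by positivity) q.2 x)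
    rintro ω ⟨t, ht, htx⟩
    obtain ⟨n, hn⟩ := exists_nat_one_div_lt ht
    obtain ⟨T, hT⟩ := exists_nat_gt t
    exact Set.mem_iUnion.2 ⟨(n, T), t, hn.le, hT, htx⟩
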